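/- Let $A$ be an arbitrary (not necessarily unital) C*-algebra with multiplier algebra $M(A)$, and let $RM(A)$ be the space of right multipliers of $A$; for $g\in RM(A)$ the left multiplier $g^*$ acts by $g^*a=(a^*g)^*$. Let $\ell^2(A)$ be the standard right Hilbert $A$-module of sequences $x=(x_i)_{i\in\mathbb N}$ in $A$ such that $\sum_i x_i^*x_i$ converges in norm, with $\langle x,y\rangle=\sum_i x_i^*y_i$. An $A$-functional on a right Hilbert $A$-module is a bounded $A$-homomorphism into $A$. An $A$-functional $\Gamma:\ell^2(A)\to A$ is called locally adjointable if $\Gamma\circ\gamma:A\to A$ is adjointable for every adjointable $\gamma:A\to\ell^2(A)$; the set of these is denoted $(\ell^2(A))'_{LA}$. Let $M(\ell^2(A))$ be the right Hilbert $M(A)$-module of all adjointable maps $\beta:A\to\ell^2(A)$, with $\langle r,s\rangle=r^*s$ and $(\beta\cdot m)(a)=\beta(ma)$; write $\beta_i\in M(A)$ for its coefficients, $\beta_i a=(\beta a)_i$. Let $(M(\ell^2(A)))'$ be the space of bounded $M(A)$-homomorphisms $M(\ell^2(A))\to M(A)$. A sequence $(\Gamma_i)$ in $RM(A)$ is said to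 define the element $\alpha\in(M(\ell^2(A)))'$ if all $\Gamma_i$ lie in $M(A)$ and, for every $\beta\in M(\ell^2(A))$, $\alpha(\beta)=\sum_i\Gamma_i^*\beta_i$ in the left strict topology, i.e. $\sum_i\Gamma_i^*\beta_i a$ converges in norm to $\alpha(\beta)a$ for every $a\in A$. Then: 1. Every $A$-functional $\Gamma:\ell^2(A)\to A$ has a unique coefficient sequence, i.e. there is exactly one sequence $(\Gamma_i)$ in $RM(A)$ such that $\Gamma(x)=\sum_i\Gamma_i^*x_i$, with norm convergence, for all $x\in\ell^2(A)$. 2. An $A$-functional $\Gamma:\ell^2(A)\to A$ with coefficient sequence $(\Gamma_i)$ is locally adjointable if and only if $(\Gamma_i)$ defines an element of $(M(\ell^2(A)))'$. 3. There is an isometric linear bijection $\Phi:(\ell^2(A))'_{LA}\to(M(\ell^2(A)))'$ (operator norms on both sides) such that, for every $\Gamma\in(\ell^2(A))'_{LA}$, the element $\Phi(\Gamma)$ is the one defined by the coefficient sequence of $\Gamma$, and such that $\Phi(\Gamma\cdot m)=\Phi(\Gamma)\cdot m$ for all $m\in M(A)$, where $(f\cdot m)(x)=m^*f(x)$ on both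 sides. In particular $(\ell^2(A))'_{LA}\cong(M(\ell^2(A)))'$. -/

import Mathlib

open MulOpposite Filter Topology
open scoped MultiplierAlgebra

namespace HilbertCStar

/-! ### Right pre-Hilbert modules over a C*-algebra -/

/-- A right (pre-)Hilbert `A`-module `E`; the right action `x · a` is written `op a • x`.
An element of a C*-algebra is positive iff it has the form `star b * b`; the module norm is the
given norm of `E`.  The remaining module axioms for the action of `A` follow from these laws. -/
class RightModule (A E : Type*) [NonUnitalCStarAlgebra A] [NormedAddCommGroup E]
    [NormedSpace ℂ E] [SMul Aᵐᵒᵖ E] where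
  /-- the `A`-valued inner product, linear in the second variable -/
  ip : E → E → A
  ip_add_right : ∀ x y z, ip x (y + z) = ip x y + ip x z
  ip_smul_right : ∀ (c : ℂ) x y, ip x (c • y) = c • ip x y
  ip_act_right : ∀ (a : A) x y, ip x (op a • y) = ip x y * a
  star_ip : ∀ x y, star (ip x y) = ip y x
  ip_self_nonneg : ∀ x, ∃ b : A, ip x x = star b * b
  ip_self_eq_zero : ∀ x, ip x x = 0 ↔ x = 0
  norm_eq : ∀ x, ‖x‖ = √‖ip x x‖

section Basic

variable (A : Type*) {E : Type*} [NonUnitalCStarAlgebra A] [NormedAddCommGroup E]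
  [NormedSpace ℂ E] [SMul Aᵐᵒᵖ E] [RightModule A E]

/-- The `A`-valued inner product of a right Hilbert `A`-module. -/
def ip (x y : E) : A := RightModule.ip x y

theorem ip_add_right (x y z : E) : ip A x (y + z) = ip A x y + ip A x z :=
  RightModule.ip_add_right x y z
theorem ip_smul_right (c : ℂ) (x y : E) : ip A x (c • y) = c • ip A x y :=
  RightModule.ip_smul_right c x y
theorem ip_act_right (a : A) (x y : E) : ip A x (op a • y) = ip A x y * a :=
  RightModule.ip_act_right a x y
theorem star_ip (x y : E) : star (ip A x y) = ip A y x := RightModule.star_ip x y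
theorem ip_self_eq_zero (x : E) : ip A x x = 0 ↔ x = 0 := RightModule.ip_self_eq_zero x
theorem ip_self_nonneg (x : E) : ∃ b : A, ip A x x = star b * b := RightModule.ip_self_nonneg x
theorem norm_sq_eq (x : E) : ‖x‖ ^ 2 = ‖ip A x x‖ := by
  rw [RightModule.norm_eq (A := A) x, Real.sq_sqrt (norm_nonneg _)]; rfl

theorem ip_sub_right (x y z : E) : ip A x (y - z) = ip A x y - ip A x z := by
  rw [sub_eq_add_neg, ← neg_one_smul ℂ z, ip_add_right, ip_smul_right, neg_one_smul, sub_eq_add_neg]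

theorem ext_ip {x y : E} (h : ∀ z : E, ip A z x = ip A z y) : x = y := by
  rw [← sub_eq_zero, ← ip_self_eq_zero A, ip_sub_right, h, sub_self]

theorem act_add (a : A) (x y : E) : op a • (x + y) = op a • x + op a • y :=
  ext_ip A fun z => by simp [ip_add_right, ip_act_right, add_mul]

theorem act_smul (a : A) (c : ℂ) (x : E) : op a • (c • x) = c • (op a • x) :=
  ext_ip A fun z => by simp [ip_smul_right, ip_act_right, smul_mul_assoc]

theorem act_zero (a : A) : op a • (0 : E) = 0 := by
  simpa using act_smul A a 0 (0 : E)

/-- A right Hilbert `A`-module is a C*-module over the opposite algebra in the sense of Mathlib. -/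
noncomputable abbrev toCStarModule (A : Type*) (E : Type*) [NonUnitalCStarAlgebra A]
    [NormedAddCommGroup E] [NormedSpace ℂ E] [SMul Aᵐᵒᵖ E] [RightModule A E] :
    letI := CStarAlgebra.spectralOrder Aᵐᵒᵖ
    CStarModule Aᵐᵒᵖ E :=
  letI := CStarAlgebra.spectralOrder Aᵐᵒᵖ
  haveI := CStarAlgebra.spectralOrderedRing Aᵐᵒᵖ
  { inner := fun x y => op (ip A x y)
    inner_add_right := by intro x y z; simp [ip_add_right]
    inner_self_nonneg := by
      intro x
      obtain ⟨b, hb⟩ := ip_self_nonneg A x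
      rw [hb, op_mul, op_star]
      exact mul_star_self_nonneg _
    inner_self := by intro x; simp [ip_self_eq_zero]
    inner_op_smul_right := by
      intro a x y
      rw [← op_unop a, ip_act_right]; simp
    inner_smul_right_complex := by intro z x y; simp [ip_smul_right]
    star_inner := by intro x y; rw [← op_star, star_ip]
    norm_eq_sqrt_norm_inner_self := by
      intro x
      rw [norm_op]; exact RightModule.norm_eq x }

theorem norm_ip_le (x y : E) : ‖ip A x y‖ ≤ ‖x‖ * ‖y‖ := by
  let _ := CStarAlgebra.spectralOrder Aᵐᵒᵖ
  have _ := CStarAlgebra.spectralOrderedRing Aᵐᵒᵖ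
  let _ := toCStarModule A E
  have := CStarModule.norm_inner_le (A := Aᵐᵒᵖ) E (x := x) (y := y)
  rwa [show inner Aᵐᵒᵖ x y = op (ip A x y) from rfl, norm_op] at this

end Basic

/-! ### Operators, adjointable and locally adjointable operators -/

section Operators

variable (A E F : Type*) [NonUnitalCStarAlgebra A]
  [NormedAddCommGroup E] [NormedSpace ℂ E] [SMul Aᵐᵒᵖ E] [RightModule A E]
  [NormedAddCommGroup F] [NormedSpace ℂ F] [SMul Aᵐᵒᵖ F] [RightModule A F]

/-- Operators: bounded `A`-homomorphisms `E → F`, with the operator norm. -/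
def operators : Submodule ℂ (E →L[ℂ] F) where
  carrier := {T | ∀ (a : A) (x : E), T (op a • x) = op a • T x}
  add_mem' := by
    intro S T hS hT a x
    simp only [Set.mem_ofPred_eq] at hS hT
    simp [hS, hT, act_add]
  zero_mem' := by intro a x; simp [act_zero]
  smul_mem' := by
    intro c T hT a x
    simp only [Set.mem_ofPred_eq] at hT
    simp [hT, act_smul]

variable {E F}

/-- `T` is an adjointable operator. -/
def IsAdjointable (T : E →L[ℂ] F) : Prop :=
  T ∈ operators A E F ∧
    ∃ S ∈ operators A F E, ∀ (x : E) (y : F), ip A (T x) y = ip A x (S y)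

variable {A} in
theorem IsAdjointable.add {S T : E →L[ℂ] F} (hS : IsAdjointable A S) (hT : IsAdjointable A T) :
    IsAdjointable A (S + T) := by
  obtain ⟨hS, S', hS', h⟩ := hS
  obtain ⟨hT, T', hT', k⟩ := hT
  refine ⟨add_mem hS hT, S' + T', add_mem hS' hT', fun x y => ?_⟩
  rw [← star_ip]
  simp only [add_apply, ip_add_right, star_add, star_ip, h, k]

variable {A} in
theorem IsAdjointable.smul {T : E →L[ℂ] F} (c : ℂ) (hT : IsAdjointable A T) :
    IsAdjointable A (c • T) := by
  obtain ⟨hT, T', hT', k⟩ := hT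
  refine ⟨Submodule.smul_mem _ c hT, star c • T', Submodule.smul_mem _ _ hT', fun x y => ?_⟩
  rw [← star_ip]
  simp only [smul_apply, ip_smul_right, star_smul, star_ip, k]

theorem IsAdjointable.zero : IsAdjointable A (0 : E →L[ℂ] F) := by
  refine ⟨zero_mem _, 0, zero_mem _, fun x y => ?_⟩
  have h : ip A y (0 : F) = 0 := by simpa using ip_smul_right A (0 : ℂ) y (0 : F)
  have k : ip A x (0 : E) = 0 := by simpa using ip_smul_right A (0 : ℂ) x (0 : E)
  simp only [zero_apply, k]
  rw [← star_ip, h, star_zero]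

variable {A} in
theorem IsAdjointable.comp {G : Type*} [NormedAddCommGroup G] [NormedSpace ℂ G] [SMul Aᵐᵒᵖ G]
    [RightModule A G] {T : F →L[ℂ] G} {S : E →L[ℂ] F}
    (hT : IsAdjointable A T) (hS : IsAdjointable A S) : IsAdjointable A (T ∘L S) := by
  obtain ⟨hS, S', hS', h⟩ := hS
  obtain ⟨hT, T', hT', k⟩ := hT
  refine ⟨fun a x => ?_, S' ∘L T', fun a x => ?_, fun x y => ?_⟩
  · simp [hS a x, hT a]
  · simp [hT' a x, hS' a]
  · simp [k, h]

variable {A} in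
/-- The adjoint operator `T^* : F → E` of an adjointable operator `T : E → F`. -/
noncomputable def adj {T : E →L[ℂ] F} (hT : IsAdjointable A T) : F →L[ℂ] E := hT.2.choose

variable {A} in
theorem adj_mem {T : E →L[ℂ] F} (hT : IsAdjointable A T) : adj hT ∈ operators A F E :=
  hT.2.choose_spec.1

variable {A} in
theorem ip_adj {T : E →L[ℂ] F} (hT : IsAdjointable A T) (x : E) (y : F) :
    ip A (T x) y = ip A x (adj hT y) :=
  hT.2.choose_spec.2 x y

variable {A} in
theorem ip_adj' {T : E →L[ℂ] F} (hT : IsAdjointable A T) (x : E) (y : F) :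
    ip A (adj hT y) x = ip A y (T x) := by
  rw [← star_ip, ← ip_adj, star_ip]

end Operators

/-- A C*-algebra as a right Hilbert module over itself: `⟨x, y⟩ = x^* y`. -/
instance instSelf (A : Type*) [NonUnitalCStarAlgebra A] : RightModule A A where
  ip x y := star x * y
  ip_add_right := by intros; rw [mul_add]
  ip_smul_right := by intros; rw [mul_smul_comm]
  ip_act_right := by intros; rw [op_smul_eq_mul, mul_assoc]
  star_ip := by intros; rw [star_mul, star_star]
  ip_self_nonneg := fun x => ⟨x, rfl⟩
  ip_self_eq_zero := fun x => CStarRing.star_mul_self_eq_zero_iff x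
  norm_eq := by intro x; rw [CStarRing.norm_star_mul_self, Real.sqrt_mul_self (norm_nonneg _)]

theorem ip_self_def {A : Type*} [NonUnitalCStarAlgebra A] (x y : A) : ip A x y = star x * y := rfl

section LocallyAdjointable

variable (A E F : Type*) [NonUnitalCStarAlgebra A]
  [NormedAddCommGroup E] [NormedSpace ℂ E] [SMul Aᵐᵒᵖ E] [RightModule A E]
  [NormedAddCommGroup F] [NormedSpace ℂ F] [SMul Aᵐᵒᵖ F] [RightModule A F]

variable {E F} in
/-- `T : E → F` is a locally adjointable operator: `T ∘ γ : A → F` is adjointable for every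
adjointable `γ : A → E`. -/
def IsLocallyAdjointable (T : E →L[ℂ] F) : Prop :=
  T ∈ operators A E F ∧
    ∀ γ : A →L[ℂ] E, IsAdjointable A γ → IsAdjointable A (T ∘L γ)

/-- The dual module `E'` of all (bounded) `A`-functionals `E → A`. -/
abbrev Dual : Submodule ℂ (E →L[ℂ] A) := operators A E A

/-- The module `E'_{LA}` of locally adjointable functionals. -/
def DualLA : Submodule ℂ (E →L[ℂ] A) where
  carrier := {Γ | IsLocallyAdjointable A Γ}
  add_mem' := fun hS hT => ⟨add_mem hS.1 hT.1, fun γ hγ => by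
    rw [ContinuousLinearMap.add_comp]; exact (hS.2 γ hγ).add (hT.2 γ hγ)⟩
  zero_mem' := ⟨zero_mem _, fun γ _ => by
    rw [ContinuousLinearMap.zero_comp]; exact IsAdjointable.zero A⟩
  smul_mem' := fun c _ hT => ⟨Submodule.smul_mem _ c hT.1, fun γ hγ => by
    rw [ContinuousLinearMap.smul_comp]; exact (hT.2 γ hγ).smul c⟩

variable {A E} in
/-- The right action of `A` on `E'`: `(f · a)(x) = a^* f(x)`. -/
noncomputable def Dual.act (f : Dual A E) (a : A) : Dual A E :=
  ⟨ContinuousLinearMap.mul ℂ A (star a) ∘L f.1, fun b x => by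
    simp [f.2 b x, mul_assoc]⟩

theorem isAdjointable_fst (m : 𝓜(ℂ, A)) : IsAdjointable A m.fst := by
  have key : ∀ m : 𝓜(ℂ, A), m.fst ∈ operators A A A := by
    intro m a x
    have h : ∀ z : A, z * m.fst (x * a) = z * (m.fst x * a) := fun z => by
      rw [← m.central, ← mul_assoc, ← mul_assoc, m.central]
    exact ext_ip A fun z => h (star z)
  refine ⟨key m, (star m).fst, key _, fun x y => ?_⟩
  rw [ip_self_def, ip_self_def, ← DoubleCentralizer.central, DoubleCentralizer.star_snd, star_star]

variable {A E} in
/-- The right action of the multiplier algebra on `E'_{LA}`, `(f · m)(x) = m^* f(x)`, extending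
the action `(f · a)(x) = a^* f(x)` of `A`. -/
noncomputable def DualLA.act (f : DualLA A E) (m : 𝓜(ℂ, A)) : DualLA A E :=
  ⟨(star m).fst ∘L f.1, fun a x => by
      have h1 := f.2.1 a x
      have h2 := (isAdjointable_fst A (star m)).1 a (f.1 x)
      simp only [ContinuousLinearMap.comp_apply]
      rw [h1, h2],
    fun γ hγ => by
      rw [ContinuousLinearMap.comp_assoc]
      exact (isAdjointable_fst A (star m)).comp (f.2.2 γ hγ)⟩

end LocallyAdjointable

/-! ### The standard module `ℓ²(A)` -/

section Standard

variable (A : Type*) [NonUnitalCStarAlgebra A]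

theorem summable_of_norm_sum_le {f g : ℕ → A} (hg : Summable g)
    (h : ∀ s : Finset ℕ, ‖∑ i ∈ s, f i‖ ≤ ‖∑ i ∈ s, g i‖) : Summable f := by
  rw [summable_iff_vanishing_norm] at hg ⊢
  intro ε hε
  obtain ⟨s, hs⟩ := hg ε hε
  exact ⟨s, fun t ht => (h t).trans_lt (hs t ht)⟩

/-- The sequences `x` in `A` for which `∑ x_i^* x_i` converges in norm. -/
def l2Submodule : Submodule ℂ (ℕ → A) where
  carrier := {x | Summable fun i => star (x i) * x i}
  add_mem' := by
    intro x y hx hy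
    simp only [Set.mem_ofPred_eq] at hx hy ⊢
    let _ := CStarAlgebra.spectralOrder A
    have _ := CStarAlgebra.spectralOrderedRing A
    refine summable_of_norm_sum_le A ((hx.add hy).const_smul (2 : ℕ)) fun s => ?_
    refine CStarAlgebra.norm_le_norm_of_nonneg_of_le
      (Finset.sum_nonneg fun i _ => star_mul_self_nonneg _) (Finset.sum_le_sum fun i _ => ?_)
    rw [← sub_nonneg]
    have : 2 • (star (x i) * x i + star (y i) * y i) - star ((x + y) i) * (x + y) i
        = star (x i - y i) * (x i - y i) := by
      simp only [Pi.add_apply, star_add, star_sub, add_mul, mul_add, sub_mul, mul_sub, two_smul]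
      abel
    rw [this]
    exact star_mul_self_nonneg _
  zero_mem' := by simp [summable_zero]
  smul_mem' := by
    intro c x hx
    simp only [Set.mem_ofPred_eq] at hx ⊢
    simpa [star_smul, smul_mul_smul_comm] using hx.const_smul (star c * c)

/-- The standard module `ℓ²(A)`. -/
def L2 : Type _ := l2Submodule A

noncomputable instance : AddCommGroup (L2 A) := inferInstanceAs (AddCommGroup (l2Submodule A))
noncomputable instance : Module ℂ (L2 A) := inferInstanceAs (Module ℂ (l2Submodule A))

variable {A}

/-- The coordinate `x_i` of `x ∈ ℓ²(A)`. -/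
def L2.coord (x : L2 A) (i : ℕ) : A := x.1 i

theorem L2.ext {x y : L2 A} (h : ∀ i, x.coord i = y.coord i) : x = y := Subtype.ext (funext h)

@[simp] theorem L2.coord_add (x y : L2 A) (i : ℕ) : (x + y).coord i = x.coord i + y.coord i := rfl
@[simp] theorem L2.coord_smul (c : ℂ) (x : L2 A) (i : ℕ) : (c • x).coord i = c • x.coord i := rfl
@[simp] theorem L2.coord_zero (i : ℕ) : (0 : L2 A).coord i = 0 := rfl

theorem L2.summable_self (x : L2 A) : Summable fun i => star (x.coord i) * x.coord i := x.2

theorem L2.summable (x y : L2 A) : Summable fun i => star (x.coord i) * y.coord i := by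
  have h : ∀ i, star (x.coord i) * y.coord i = (4⁻¹ : ℂ) •
      (star ((x + y).coord i) * (x + y).coord i
        - star ((x + (-1 : ℂ) • y).coord i) * (x + (-1 : ℂ) • y).coord i
        - Complex.I • (star ((x + Complex.I • y).coord i) * (x + Complex.I • y).coord i)
        + Complex.I • (star ((x + (-Complex.I) • y).coord i)
          * (x + (-Complex.I) • y).coord i)) := by
    intro i
    simp only [L2.coord_add, L2.coord_smul, star_add, star_smul, add_mul, mul_add, smul_mul_assoc,
      mul_smul_comm, smul_add, smul_sub, smul_smul, RCLike.star_def, map_neg, Complex.conj_I,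
      map_one]
    ring_nf
    simp only [Complex.I_sq]
    module
  simp_rw [h]
  exact Summable.const_smul _ ((((x + y).summable_self.sub (L2.summable_self _)).sub
    ((L2.summable_self _).const_smul _)).add ((L2.summable_self _).const_smul _))

/-- The right action `x · a` on `ℓ²(A)`, coordinatewise. -/
instance : SMul Aᵐᵒᵖ (L2 A) where
  smul a x := ⟨fun i => x.coord i * unop a, by
    have h := (x.summable_self.mul_left (star (unop a))).mul_right (unop a)
    simpa [l2Submodule, star_mul, mul_assoc] using h⟩

@[simp] theorem L2.coord_act (a : A) (x : L2 A) (i : ℕ) : (op a • x).coord i = x.coord i * a := rfl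

/-- `⟨x, y⟩ = ∑ x_i^* y_i`. -/
noncomputable def L2.inner (x y : L2 A) : A := ∑' i, star (x.coord i) * y.coord i

theorem L2.inner_self_nonneg (x : L2 A) : ∃ b : A, L2.inner x x = star b * b := by
  let _ := CStarAlgebra.spectralOrder A
  have _ := CStarAlgebra.spectralOrderedRing A
  rw [← CStarAlgebra.nonneg_iff_eq_star_mul_self]
  exact tsum_nonneg fun i => star_mul_self_nonneg _

theorem L2.inner_self_eq_zero (x : L2 A) : L2.inner x x = 0 ↔ x = 0 := by
  let _ := CStarAlgebra.spectralOrder A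
  have _ := CStarAlgebra.spectralOrderedRing A
  refine ⟨fun h => L2.ext fun i => ?_, fun h => by simp [h, L2.inner]⟩
  have h1 : HasSum (fun i => star (x.coord i) * x.coord i) 0 := h ▸ x.summable_self.hasSum
  rw [hasSum_zero_iff_of_nonneg fun i => star_mul_self_nonneg _] at h1
  exact (CStarRing.star_mul_self_eq_zero_iff _).1 (congrFun h1 i)

theorem L2.inner_add_right (x y z : L2 A) : L2.inner x (y + z) = L2.inner x y + L2.inner x z := by
  simp only [L2.inner, L2.coord_add, mul_add]
  exact (x.summable y).tsum_add (x.summable z)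

theorem L2.inner_smul_right (c : ℂ) (x y : L2 A) : L2.inner x (c • y) = c • L2.inner x y := by
  simp only [L2.inner, L2.coord_smul, mul_smul_comm]
  exact (x.summable y).tsum_const_smul c

theorem L2.inner_act_right (a : A) (x y : L2 A) : L2.inner x (op a • y) = L2.inner x y * a := by
  simp only [L2.inner, L2.coord_act, ← mul_assoc]
  exact (x.summable y).tsum_mul_right a

theorem L2.star_inner (x y : L2 A) : star (L2.inner x y) = L2.inner y x := by
  simp only [L2.inner, tsum_star, star_mul, star_star]

/-- `‖x‖ = ‖⟨x, x⟩‖^{1/2}`. -/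
noncomputable instance : Norm (L2 A) := ⟨fun x => √‖L2.inner x x‖⟩

theorem L2.normedSpaceCore : NormedSpace.Core ℂ (L2 A) :=
  letI := CStarAlgebra.spectralOrder Aᵐᵒᵖ
  haveI := CStarAlgebra.spectralOrderedRing Aᵐᵒᵖ
  letI : CStarModule Aᵐᵒᵖ (L2 A) :=
    { inner := fun x y => op (L2.inner x y)
      inner_add_right := by intro x y z; simp [L2.inner_add_right]
      inner_self_nonneg := by
        intro x
        obtain ⟨b, hb⟩ := L2.inner_self_nonneg x
        rw [hb, op_mul, op_star]
        exact mul_star_self_nonneg _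
      inner_self := by intro x; simp [L2.inner_self_eq_zero]
      inner_op_smul_right := by
        intro a x y
        rw [← op_unop a, L2.inner_act_right]; simp
      inner_smul_right_complex := by intro z x y; simp [L2.inner_smul_right]
      star_inner := by intro x y; rw [← op_star, L2.star_inner]
      norm_eq_sqrt_norm_inner_self := fun _ => rfl }
  CStarModule.normedSpaceCore Aᵐᵒᵖ

noncomputable instance : NormedAddCommGroup (L2 A) := .ofCore L2.normedSpaceCore
noncomputable instance : NormedSpace ℂ (L2 A) := .ofCore L2.normedSpaceCore

/-- The standard module `ℓ²(A)` as a right Hilbert `A`-module, `⟨x, y⟩ = ∑ x_i^* y_i`. -/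
noncomputable instance : RightModule A (L2 A) where
  ip := L2.inner
  ip_add_right := L2.inner_add_right
  ip_smul_right := L2.inner_smul_right
  ip_act_right := L2.inner_act_right
  star_ip := L2.star_inner
  ip_self_nonneg := L2.inner_self_nonneg
  ip_self_eq_zero := L2.inner_self_eq_zero
  norm_eq := fun _ => rfl

end Standard

/-! ### The multiplier module `M(N)` -/

section MultiplierModule

variable (A N : Type*) [NonUnitalCStarAlgebra A]
  [NormedAddCommGroup N] [NormedSpace ℂ N] [SMul Aᵐᵒᵖ N] [RightModule A N]

/-- The multiplier module `M(N)`: the adjointable maps `A → N`, with the operator norm. -/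
def MultiplierModule : Submodule ℂ (A →L[ℂ] N) where
  carrier := {r | IsAdjointable A r}
  add_mem' := fun hS hT => hS.add hT
  zero_mem' := IsAdjointable.zero A
  smul_mem' := fun c _ hT => hT.smul c

variable {A N}

/-- The right action of `M(A)` on `M(N)`: `(r · m)(a) = r (m a)`. -/
instance : SMul (𝓜(ℂ, A))ᵐᵒᵖ (MultiplierModule A N) where
  smul m r := ⟨r.1 ∘L (unop m).fst, IsAdjointable.comp r.2 (isAdjointable_fst A (unop m))⟩

@[simp] theorem MultiplierModule.act_apply (m : 𝓜(ℂ, A)) (r : MultiplierModule A N) (a : A) :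
    (op m • r).1 a = r.1 (m.fst a) := rfl

theorem fst_star_ip (r s : A →L[ℂ] N) (hr : IsAdjointable A r) (hs : IsAdjointable A s) (x y : A) :
    star (adj hs (r (star x))) * y = x * adj hr (s y) := by
  have h1 := ip_adj' hs y (r (star x))
  have h2 := ip_adj hr (star x) (s y)
  simp only [ip_self_def] at h2
  rw [ip_self_def] at h1
  rw [h1, h2, star_star]

/-- The `M(A)`-valued inner product `⟨r, s⟩ = r^* s` of `M(N)`, i.e. `⟨r, s⟩ a = r^*(s a)`. -/
noncomputable def MultiplierModule.inner (r s : MultiplierModule A N) : 𝓜(ℂ, A) where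
  fst := adj r.2 ∘L s.1
  snd := (((starₗᵢ ℂ : A ≃ₗᵢ⋆[ℂ] A) : A →L⋆[ℂ] A).comp (adj s.2 ∘L r.1)).comp
          ((starₗᵢ ℂ : A ≃ₗᵢ⋆[ℂ] A) : A →L⋆[ℂ] A)
  central := fun x y => fst_star_ip r.1 s.1 r.2 s.2 x y

@[simp] theorem MultiplierModule.inner_fst (r s : MultiplierModule A N) (a : A) :
    (MultiplierModule.inner r s).fst a = adj r.2 (s.1 a) := rfl

theorem multiplier_ext {m n : 𝓜(ℂ, A)} (h : ∀ a, m.fst a = n.fst a) : m = n := by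
  refine DoubleCentralizer.ext ℂ A _ _ (Prod.ext (ContinuousLinearMap.ext h)
    (ContinuousLinearMap.ext fun x => ?_))
  have : ∀ y, m.snd x * y = n.snd x * y := fun y => by rw [m.central, n.central, h]
  have h2 : (m.snd x - n.snd x) * star (m.snd x - n.snd x) = 0 := by
    rw [sub_mul, this, sub_self]
  exact sub_eq_zero.1 ((CStarRing.mul_star_self_eq_zero_iff _).1 h2)

theorem MultiplierModule.ip_inner (r s : MultiplierModule A N) (a b : A) :
    ip A (r.1 a) (s.1 b) = star a * (MultiplierModule.inner r s).fst b := by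
  rw [ip_adj r.2, ip_self_def]; rfl

theorem MultiplierModule.inner_ext {r s : MultiplierModule A N} {m : 𝓜(ℂ, A)}
    (h : ∀ a b, ip A (r.1 a) (s.1 b) = star a * m.fst b) : MultiplierModule.inner r s = m :=
  multiplier_ext fun b => ext_ip A fun a => by
    rw [ip_self_def, ip_self_def, ← h, MultiplierModule.ip_inner]

theorem MultiplierModule.star_inner (r s : MultiplierModule A N) :
    star (MultiplierModule.inner r s) = MultiplierModule.inner s r := by
  refine (MultiplierModule.inner_ext fun a b => ?_).symm
  rw [DoubleCentralizer.star_fst, ← star_mul, ← star_ip, MultiplierModule.ip_inner]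
  congr 1
  rw [DoubleCentralizer.central]

theorem multiplier_nonneg {h : 𝓜(ℂ, A)} (hs : star h = h)
    (hh : ∀ a : A, ∃ b : A, star a * h.fst a = star b * b) : ∃ c : 𝓜(ℂ, A), h = star c * c := by
  let _ := CStarAlgebra.spectralOrder A
  have _ := CStarAlgebra.spectralOrderedRing A
  let _ := CStarAlgebra.spectralOrder 𝓜(ℂ, A)
  have _ := CStarAlgebra.spectralOrderedRing 𝓜(ℂ, A)
  have hsa : IsSelfAdjoint h := hs
  set p := h⁻ with hp
  have hp0 : 0 ≤ p := CFC.negPart_nonneg h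
  have hps : star p = p := (IsSelfAdjoint.of_nonneg hp0)
  have hph : p * h * p = - (p * p * p) := by
    have h1 : h⁺ * p = 0 := CFC.posPart_mul_negPart h
    have h2 : h = h⁺ - p := (CFC.posPart_sub_negPart h hsa).symm
    have h3 : h * p = - (p * p) := by
      calc h * p = (h⁺ - p) * p := by rw [← h2]
        _ = - (p * p) := by rw [sub_mul, h1, zero_sub]
    rw [mul_assoc, h3, mul_neg, mul_assoc]
  have hp3 : 0 ≤ p * p * p := by
    have := star_left_conjugate_nonneg hp0 p
    rwa [hps] at this
  obtain ⟨c, hc⟩ := CStarAlgebra.nonneg_iff_eq_star_mul_self.1 hp3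
  have hfst : ∀ (m : 𝓜(ℂ, A)) (a : A), star (m.fst a) * m.fst a = star a * (star m * m).fst a := by
    intro m a
    rw [DoubleCentralizer.mul_fst]
    have := DoubleCentralizer.central (star m) (star a) (m.fst a)
    rw [DoubleCentralizer.star_snd, star_star] at this
    exact this
  have hc0 : ∀ a, c.fst a = 0 := by
    intro a
    obtain ⟨b, hb⟩ := hh (p.fst a)
    have h1 : star (p.fst a) * h.fst (p.fst a) = star a * (p * h * p).fst a := by
      have := DoubleCentralizer.central (star p) (star a) (h.fst (p.fst a))
      rw [DoubleCentralizer.star_snd, star_star, hps] at this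
      exact this
    rw [hph, hc] at h1
    have h2 : star b * b = - (star (c.fst a) * c.fst a) := by
      rw [← hb, h1, hfst, ← mul_neg (star a)]; rfl
    have h3 : star (c.fst a) * c.fst a ≤ 0 := by
      rw [← neg_nonneg, ← h2]; exact star_mul_self_nonneg _
    exact (CStarRing.star_mul_self_eq_zero_iff _).1 (le_antisymm h3 (star_mul_self_nonneg _))
  have hc' : c = 0 := multiplier_ext hc0
  rw [hc', mul_zero] at hc
  have h4 : star (p * p) * (p * p) = 0 := by
    rw [star_mul, hps, ← mul_assoc, hc, zero_mul]
  have h5 : star p * p = 0 := by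
    rw [hps]; exact (CStarRing.star_mul_self_eq_zero_iff _).1 h4
  have h6 : p = 0 := (CStarRing.star_mul_self_eq_zero_iff _).1 h5
  have h7 : 0 ≤ h := by
    have h2 : h = h⁺ - p := (CFC.posPart_sub_negPart h hsa).symm
    rw [h2, h6, sub_zero]
    exact CFC.posPart_nonneg h
  exact CStarAlgebra.nonneg_iff_eq_star_mul_self.1 h7

theorem norm_adj_le {T : A →L[ℂ] N} (hT : IsAdjointable A T) : ‖adj hT‖ ≤ ‖T‖ := by
  refine ContinuousLinearMap.opNorm_le_bound _ (norm_nonneg _) fun y => ?_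
  have h : ‖adj hT y‖ ^ 2 ≤ ‖T‖ * ‖adj hT y‖ * ‖y‖ := by
    rw [norm_sq_eq A, ← ip_adj]
    exact (norm_ip_le A _ _).trans (mul_le_mul_of_nonneg_right (T.le_opNorm _) (norm_nonneg _))
  by_cases h0 : ‖adj hT y‖ = 0
  · rw [h0]; positivity
  · have : 0 < ‖adj hT y‖ := lt_of_le_of_ne (norm_nonneg _) (Ne.symm h0)
    nlinarith

theorem MultiplierModule.norm_sq (r : MultiplierModule A N) :
    ‖r‖ ^ 2 = ‖MultiplierModule.inner r r‖ := by
  apply le_antisymm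
  · refine (Real.le_sqrt (norm_nonneg r) (norm_nonneg _)).1 ?_
    refine ContinuousLinearMap.opNorm_le_bound _ (Real.sqrt_nonneg _) fun a => ?_
    change ‖r.1 a‖ ≤ _
    refine le_of_sq_le_sq ?_ (by positivity)
    rw [norm_sq_eq A, MultiplierModule.ip_inner, mul_pow, Real.sq_sqrt (norm_nonneg _)]
    refine (norm_mul_le _ _).trans ?_
    rw [norm_star, ← DoubleCentralizer.norm_fst]
    have := (MultiplierModule.inner r r).fst.le_opNorm a
    nlinarith [norm_nonneg a]
  · rw [← DoubleCentralizer.norm_fst]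
    refine (ContinuousLinearMap.opNorm_comp_le (adj r.2) r.1).trans ?_
    rw [sq]
    exact mul_le_mul_of_nonneg_right (norm_adj_le r.2) (norm_nonneg _)

/-- `M(N)` is a right Hilbert `M(A)`-module with inner product `⟨r, s⟩ = r^* s`. -/
noncomputable instance : RightModule 𝓜(ℂ, A) (MultiplierModule A N) where
  ip := MultiplierModule.inner
  ip_add_right := fun r s t => MultiplierModule.inner_ext fun a b => by
    change ip A (r.1 a) (s.1 b + t.1 b) =
      star a * ((MultiplierModule.inner r s).fst b + (MultiplierModule.inner r t).fst b)
    rw [ip_add_right, mul_add, MultiplierModule.ip_inner, MultiplierModule.ip_inner]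
  ip_smul_right := fun c r s => MultiplierModule.inner_ext fun a b => by
    change ip A (r.1 a) (c • s.1 b) = star a * (c • (MultiplierModule.inner r s).fst b)
    rw [ip_smul_right, mul_smul_comm, MultiplierModule.ip_inner]
  ip_act_right := fun m r s => MultiplierModule.inner_ext fun a b => by
    rw [MultiplierModule.act_apply, MultiplierModule.ip_inner]; rfl
  star_ip := MultiplierModule.star_inner
  ip_self_nonneg := fun r => multiplier_nonneg (MultiplierModule.star_inner r r) fun a => by
    rw [← MultiplierModule.ip_inner]; exact ip_self_nonneg A _
  ip_self_eq_zero := fun r => by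
    rw [← norm_eq_zero, ← MultiplierModule.norm_sq]; simp
  norm_eq := fun r => by rw [← MultiplierModule.norm_sq, Real.sqrt_sq (norm_nonneg r)]

end MultiplierModule

/-! ### Coefficients -/

section Coefficients

variable (A : Type*) [NonUnitalCStarAlgebra A]

/-- `RM(A)`: right multipliers, i.e. bounded maps `a ↦ a g` with `(b a) g = b (a g)`. -/
def RM : Submodule ℂ (A →L[ℂ] A) where
  carrier := {g | ∀ b a : A, g (b * a) = b * g a}
  add_mem' := by
    intro S T hS hT b a
    simp only [Set.mem_ofPred_eq] at hS hT
    simp [hS, hT, mul_add]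
  zero_mem' := by intro b a; simp
  smul_mem' := by
    intro c T hT b a
    simp only [Set.mem_ofPred_eq] at hT
    simp [hT, mul_smul_comm]

variable {A}

/-- The left multiplier `g^* ∈ LM(A)` of a right multiplier `g`, applied to `a`:
`g^* a = (a^* g)^*`. -/
def RM.starMul (g : RM A) (a : A) : A := star (g.1 (star a))

/-- The inclusion `M(A) ⊆ RM(A)`. -/
def RM.ofMultiplier (m : 𝓜(ℂ, A)) : RM A :=
  ⟨m.snd, fun b a => by
    have h : ∀ z, m.snd (b * a) * z = b * m.snd a * z := fun z => by
      rw [m.central, mul_assoc, mul_assoc, m.central]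
    have h2 : (m.snd (b * a) - b * m.snd a) * star (m.snd (b * a) - b * m.snd a) = 0 := by
      rw [sub_mul, h, sub_self]
    exact sub_eq_zero.1 ((CStarRing.mul_star_self_eq_zero_iff _).1 h2)⟩

/-- `(g_i)` is the coefficient sequence of the functional `Γ : ℓ²(A) → A`:
`Γ x = ∑ g_i^* x_i` with norm convergence, for all `x`. -/
def IsCoeff (Γ : Dual A (L2 A)) (g : ℕ → RM A) : Prop :=
  ∀ x : L2 A, Tendsto (fun n => ∑ i ∈ Finset.range n, RM.starMul (g i) (x.coord i)) atTop (𝓝 (Γ.1 x))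

/-- The sequence `(g_i)` in `RM(A)` defines the element `α` of `(M(ℓ²(A)))'`: every `g_i` is a
two-sided multiplier `m_i ∈ M(A)`, and for every `β ∈ M(ℓ²(A))`, with coefficients
`β_i ∈ M(A)`, `β_i a = (β a)_i`, one has `α β = ∑ m_i^* β_i`, the series converging left strictly,
i.e. in norm after being applied to any `a ∈ A`. -/
def Defines (g : ℕ → RM A) (α : Dual 𝓜(ℂ, A) (MultiplierModule A (L2 A))) : Prop :=
  ∃ m : ℕ → 𝓜(ℂ, A), (∀ i, RM.ofMultiplier (m i) = g i) ∧
    ∀ (β : MultiplierModule A (L2 A)) (a : A),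
      Tendsto (fun n => ∑ i ∈ Finset.range n, (star (m i)).fst ((β.1 a).coord i)) atTop
        (𝓝 ((α.1 β).fst a))

end Coefficients

end HilbertCStar

/-!
A module `N` sits isometrically in `M(N)` through `x ↦ (a ↦ x · a)`, and `β · a` is the image of
`β a ∈ N` for all `β ∈ M(N)` and `a ∈ A`. A locally adjointable functional `Γ` on `N` therefore
extends to `M(N)` by `β ↦ Γ ∘ β`, an adjointable operator on `A` being the same thing as an element
of `M(A)`. Conversely, a functional `α` on `M(N)` satisfies `α(x · a) = α(x) a ∈ A`; as `N A` is
dense in `N` and `A` is closed in `M(A)`, `α` maps `N` to `A`, and the restriction `Γ` of `α` is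
locally adjointable since `Γ ∘ β = α(β)`.

In `ℓ²(A)` every `x` is the sum of the vectors with the single entry `x_i`, so the coefficients of
`Γ` are its restrictions to the summands. The series of a coefficient sequence at `β a` has sum
`Γ(β a)`, so the sequence defines `α` precisely when `α(β) = Γ ∘ β` for all `β`.
-/

namespace HilbertCStar

section Modules

variable {A N : Type*} [NonUnitalCStarAlgebra A]
  [NormedAddCommGroup N] [NormedSpace ℂ N] [SMul Aᵐᵒᵖ N] [RightModule A N]

theorem ip_sub_left (x y z : N) : ip A (x - y) z = ip A x z - ip A y z := by
  rw [← star_ip, ip_sub_right, star_sub, star_ip, star_ip]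

theorem ip_act_left (a : A) (x y : N) : ip A (op a • x) y = star a * ip A x y := by
  rw [← star_ip, ip_act_right, star_mul, star_ip]

theorem add_act (a b : A) (x : N) : op (a + b) • x = op a • x + op b • x :=
  ext_ip A fun z => by simp only [ip_add_right, ip_act_right, mul_add]

theorem smul_act (c : ℂ) (a : A) (x : N) : op (c • a) • x = c • (op a • x) :=
  ext_ip A fun z => by simp only [ip_smul_right, ip_act_right, mul_smul_comm]

theorem mul_act (a b : A) (x : N) : op (a * b) • x = op b • (op a • x) :=
  ext_ip A fun z => by simp only [ip_act_right, mul_assoc]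

theorem norm_act_le (a : A) (x : N) : ‖op a • x‖ ≤ ‖x‖ * ‖a‖ := by
  refine le_of_sq_le_sq ?_ (by positivity)
  calc ‖op a • x‖ ^ 2 = ‖star a * ip A x x * a‖ := by rw [norm_sq_eq A, ip_act_right, ip_act_left]
    _ ≤ ‖star a‖ * ‖ip A x x‖ * ‖a‖ := norm_mul₃_le
    _ = (‖x‖ * ‖a‖) ^ 2 := by rw [norm_star, ← norm_sq_eq A]; ring

variable (A) in
/-- The functional `y ↦ ⟨x, y⟩` as a bounded operator. -/
noncomputable def ipCLM (x : N) : N →L[ℂ] A :=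
  LinearMap.mkContinuous
    { toFun := ip A x
      map_add' := ip_add_right A x
      map_smul' := fun c => ip_smul_right A c x } ‖x‖ (norm_ip_le A x)

theorem ip_sum_right {ι : Type*} (x : N) (s : Finset ι) (f : ι → N) :
    ip A x (∑ i ∈ s, f i) = ∑ i ∈ s, ip A x (f i) :=
  map_sum (ipCLM A x) f s

variable (A) in
/-- The operator `a ↦ x · a` from `A` to `N`. -/
noncomputable def actCLM (x : N) : A →L[ℂ] N :=
  LinearMap.mkContinuous
    { toFun := fun a => op a • x
      map_add' := fun a b => add_act a b x
      map_smul' := fun c a => smul_act c a x } ‖x‖ fun a => norm_act_le a x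

@[simp] theorem actCLM_apply (x : N) (a : A) : actCLM A x a = op a • x := rfl

theorem isAdjointable_actCLM (x : N) : IsAdjointable A (actCLM A x) :=
  ⟨fun a b => mul_act b a x, ipCLM A x, fun a => ip_act_right A a x, fun a => ip_act_left a x⟩

theorem norm_act_sub_sq_le (x : N) {e : A} (he : ‖e‖ ≤ 1) :
    ‖op e • x - x‖ ^ 2 ≤ 2 * ‖ip A x x * e - ip A x x‖ := by
  set d := ip A x x * e - ip A x x with hd
  calc ‖op e • x - x‖ ^ 2 = ‖star e * d - d‖ := by
        simp only [norm_sq_eq A, hd, ip_sub_left, ip_sub_right, ip_act_left, ip_act_right, mul_sub,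
          sub_mul, mul_assoc]
        congr 1
        abel
    _ ≤ ‖star e‖ * ‖d‖ + ‖d‖ := (norm_sub_le _ _).trans (by gcongr; exact norm_mul_le _ _)
    _ ≤ 1 * ‖d‖ + ‖d‖ := by rw [norm_star]; gcongr
    _ = 2 * ‖d‖ := by ring

theorem tendsto_act_of_isIncreasingApproximateUnit [PartialOrder A] {l : Filter A}
    (hl : l.IsIncreasingApproximateUnit) (x : N) : Tendsto (fun e => op e • x) l (𝓝 x) := by
  have hbound : Tendsto (fun e => √(2 * ‖ip A x x * e - ip A x x‖)) l (𝓝 0) := by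
    simpa using
      ((tendsto_iff_norm_sub_tendsto_zero.1 (hl.tendsto_mul_left (ip A x x))).const_mul 2).sqrt
  refine tendsto_iff_norm_sub_tendsto_zero.2
    (squeeze_zero' (.of_forall fun _ => norm_nonneg _) ?_ hbound)
  filter_upwards [hl.eventually_norm] with e he
  exact Real.le_sqrt_of_sq_le (norm_act_sub_sq_le x he)

variable (A) in
theorem mem_closure_range_act (x : N) : x ∈ closure (Set.range fun a : A => op a • x) := by
  let _ := CStarAlgebra.spectralOrder A
  have _ := CStarAlgebra.spectralOrderedRing A
  have hl := CStarAlgebra.increasingApproximateUnit A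
  have := hl.neBot
  exact mem_closure_of_tendsto (tendsto_act_of_isIncreasingApproximateUnit hl x)
    (.of_forall Set.mem_range_self)

end Modules

section Multipliers

variable {A : Type*} [NonUnitalCStarAlgebra A]

/-- The conjugate `a ↦ (T a^*)^*` of an operator on `A` by the involution; it interchanges left and
right multipliers. -/
noncomputable def starConj (T : A →L[ℂ] A) : A →L[ℂ] A :=
  (((starₗᵢ ℂ : A ≃ₗᵢ⋆[ℂ] A) : A →L⋆[ℂ] A).comp T).comp ((starₗᵢ ℂ : A ≃ₗᵢ⋆[ℂ] A) : A →L⋆[ℂ] A)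

@[simp] theorem starConj_apply (T : A →L[ℂ] A) (a : A) : starConj T a = star (T (star a)) := rfl

/-- An adjointable operator `T` on `A` as an element of `M(A)`, with `T` as its left action. -/
noncomputable def IsAdjointable.toMultiplier {T : A →L[ℂ] A} (hT : IsAdjointable A T) :
    𝓜(ℂ, A) where
  fst := T
  snd := starConj (adj hT)
  central a b := by simpa only [starConj_apply, ip_self_def, star_star] using ip_adj' hT b (star a)

theorem IsAdjointable.norm_toMultiplier {T : A →L[ℂ] A} (hT : IsAdjointable A T) :
    ‖hT.toMultiplier‖ = ‖T‖ :=
  (DoubleCentralizer.norm_fst _).symm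

theorem multiplier_mul_coe (m : 𝓜(ℂ, A)) (a : A) : m * (a : 𝓜(ℂ, A)) = (m.fst a : A) :=
  multiplier_ext fun b => (isAdjointable_fst A m).1 b a

variable (A) in
/-- The inclusion of `A` in `M(A)`, which is isometric. -/
noncomputable def coeMultiplier : A →ₗᵢ[ℂ] 𝓜(ℂ, A) where
  toLinearMap := (DoubleCentralizer.coeHom : A →⋆ₙₐ[ℂ] 𝓜(ℂ, A))
  norm_map' a := by
    change ‖(a : 𝓜(ℂ, A))‖ = ‖a‖
    rw [← DoubleCentralizer.norm_fst, DoubleCentralizer.coe_fst]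
    exact (ContinuousLinearMap.isometry_mul ℂ A).norm_map_of_map_zero (map_zero _) a

@[simp] theorem coeMultiplier_apply (a : A) : coeMultiplier A a = (a : 𝓜(ℂ, A)) := rfl

theorem isClosed_range_coeMultiplier : IsClosed (Set.range (coeMultiplier A)) :=
  (coeMultiplier A).isometry.isClosedEmbedding.isClosed_range

end Multipliers

section MultiplierModules

variable {A N : Type*} [NonUnitalCStarAlgebra A]
  [NormedAddCommGroup N] [NormedSpace ℂ N] [SMul Aᵐᵒᵖ N] [RightModule A N]

theorem inner_actCLM (x y : N) :
    MultiplierModule.inner ⟨actCLM A x, isAdjointable_actCLM x⟩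
      ⟨actCLM A y, isAdjointable_actCLM y⟩ = (ip A x y : A) :=
  MultiplierModule.inner_ext fun a b => by
    rw [actCLM_apply, actCLM_apply, ip_act_left, ip_act_right, DoubleCentralizer.coe_fst,
      ContinuousLinearMap.mul_apply']

theorem norm_actCLM (x : N) : ‖actCLM A x‖ = ‖x‖ := by
  let r : MultiplierModule A N := ⟨actCLM A x, isAdjointable_actCLM x⟩
  refine (sq_eq_sq₀ (norm_nonneg _) (norm_nonneg _)).1 ?_
  calc ‖actCLM A x‖ ^ 2 = ‖MultiplierModule.inner r r‖ := MultiplierModule.norm_sq r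
    _ = ‖coeMultiplier A (ip A x x)‖ := congrArg norm (inner_actCLM x x)
    _ = ‖x‖ ^ 2 := by rw [LinearIsometry.norm_map, ← norm_sq_eq A]

variable (A) in
/-- The embedding `N → M(N)` sending `x` to `a ↦ x · a`. It preserves inner products, hence
norms. -/
noncomputable def toMultiplierModule : N →ₗᵢ[ℂ] MultiplierModule A N where
  toFun x := ⟨actCLM A x, isAdjointable_actCLM x⟩
  map_add' x y := Subtype.ext (ContinuousLinearMap.ext fun a => act_add A a x y)
  map_smul' c x := Subtype.ext (ContinuousLinearMap.ext fun a => act_smul A a c x)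
  norm_map' := norm_actCLM

theorem toMultiplierModule_apply_eq_act (β : MultiplierModule A N) (a : A) :
    toMultiplierModule A (β.1 a) = op (a : 𝓜(ℂ, A)) • β :=
  Subtype.ext (ContinuousLinearMap.ext fun b => (β.2.1 b a).symm)

theorem toMultiplierModule_act (a : A) (x : N) :
    toMultiplierModule A (op a • x) = op (a : 𝓜(ℂ, A)) • toMultiplierModule A x :=
  toMultiplierModule_apply_eq_act (toMultiplierModule A x) a

end MultiplierModules

section Duality

variable {A N : Type*} [NonUnitalCStarAlgebra A]
  [NormedAddCommGroup N] [NormedSpace ℂ N] [SMul Aᵐᵒᵖ N] [RightModule A N]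

/-- The functional `β ↦ Γ ∘ β` on `M(N)` induced by a locally adjointable functional `Γ` on `N`. -/
noncomputable def DualLA.extend (Γ : DualLA A N) : Dual 𝓜(ℂ, A) (MultiplierModule A N) :=
  ⟨LinearMap.mkContinuous
    { toFun := fun β => (Γ.2.2 β.1 β.2).toMultiplier
      map_add' := fun β γ => multiplier_ext fun a => map_add Γ.1 (β.1 a) (γ.1 a)
      map_smul' := fun c β => multiplier_ext fun a => map_smul Γ.1 c (β.1 a) } ‖Γ‖ fun β =>
        (Γ.2.2 β.1 β.2).norm_toMultiplier.trans_le (Γ.1.opNorm_comp_le β.1),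
    fun _ _ => multiplier_ext fun _ => rfl⟩

theorem DualLA.extend_apply_fst (Γ : DualLA A N) (β : MultiplierModule A N) :
    ((DualLA.extend Γ).1 β).fst = Γ.1 ∘L β.1 := rfl

theorem DualLA.extend_toMultiplierModule (Γ : DualLA A N) (x : N) :
    (DualLA.extend Γ).1 (toMultiplierModule A x) = coeMultiplier A (Γ.1 x) :=
  multiplier_ext fun a => Γ.2.1 a x

theorem DualLA.norm_extend (Γ : DualLA A N) : ‖DualLA.extend Γ‖ = ‖Γ‖ := by
  refine le_antisymm
    (ContinuousLinearMap.opNorm_le_bound _ (norm_nonneg _) fun β =>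
      (Γ.2.2 β.1 β.2).norm_toMultiplier.trans_le (Γ.1.opNorm_comp_le β.1))
    (ContinuousLinearMap.opNorm_le_bound _ (norm_nonneg _) fun x => ?_)
  calc ‖Γ.1 x‖ = ‖(DualLA.extend Γ).1 (toMultiplierModule A x)‖ := by
        rw [DualLA.extend_toMultiplierModule, LinearIsometry.norm_map]
    _ ≤ ‖DualLA.extend Γ‖ * ‖toMultiplierModule A x‖ := (DualLA.extend Γ).1.le_opNorm _
    _ = ‖DualLA.extend Γ‖ * ‖x‖ := by rw [LinearIsometry.norm_map]

theorem isLocallyAdjointable_iff_exists_fst_eq_comp (Γ : Dual A N) :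
    IsLocallyAdjointable A Γ.1 ↔
      ∃ α : Dual 𝓜(ℂ, A) (MultiplierModule A N), ∀ β, (α.1 β).fst = Γ.1 ∘L β.1 :=
  ⟨fun hΓ => ⟨DualLA.extend ⟨Γ.1, hΓ⟩, DualLA.extend_apply_fst _⟩,
    fun ⟨_, hα⟩ => ⟨Γ.2, fun γ hγ => hα ⟨γ, hγ⟩ ▸ isAdjointable_fst A _⟩⟩

theorem Dual.apply_toMultiplierModule_apply (α : Dual 𝓜(ℂ, A) (MultiplierModule A N))
    (β : MultiplierModule A N) (a : A) :
    α.1 (toMultiplierModule A (β.1 a)) = coeMultiplier A ((α.1 β).fst a) := by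
  rw [toMultiplierModule_apply_eq_act, α.2, op_smul_eq_mul, multiplier_mul_coe,
    coeMultiplier_apply]

theorem Dual.apply_toMultiplierModule_mem_range (α : Dual 𝓜(ℂ, A) (MultiplierModule A N)) (x : N) :
    α.1 (toMultiplierModule A x) ∈ LinearMap.range (coeMultiplier A).toLinearMap := by
  have hcont : Continuous fun y => α.1 (toMultiplierModule A y) :=
    α.1.continuous.comp (toMultiplierModule A).continuous
  refine closure_minimal ?_ (isClosed_range_coeMultiplier.preimage hcont)
    (mem_closure_range_act A x)
  rintro _ ⟨a, rfl⟩
  exact ⟨_, (Dual.apply_toMultiplierModule_apply α (toMultiplierModule A x) a).symm⟩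

/-- The restriction to `N ⊆ M(N)` of a functional on `M(N)`, which takes its values in
`A ⊆ M(A)`, as a bounded operator. -/
noncomputable def Dual.restrictCLM (α : Dual 𝓜(ℂ, A) (MultiplierModule A N)) : N →L[ℂ] A :=
  ((coeMultiplier A).equivRange.symm : _ →L[ℂ] A) ∘L
    (α.1 ∘L (toMultiplierModule A).toContinuousLinearMap).codRestrict _
      (Dual.apply_toMultiplierModule_mem_range α)

theorem Dual.coeMultiplier_restrictCLM (α : Dual 𝓜(ℂ, A) (MultiplierModule A N)) (x : N) :
    coeMultiplier A (Dual.restrictCLM α x) = α.1 (toMultiplierModule A x) :=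
  congrArg Subtype.val ((coeMultiplier A).equivRange.apply_symm_apply _)

/-- The functional on `N` obtained by restricting a functional on `M(N)`. -/
noncomputable def Dual.restrict (α : Dual 𝓜(ℂ, A) (MultiplierModule A N)) : Dual A N :=
  ⟨Dual.restrictCLM α, fun a x => (coeMultiplier A).injective <| by
    rw [Dual.coeMultiplier_restrictCLM, toMultiplierModule_act, α.2,
      ← Dual.coeMultiplier_restrictCLM, op_smul_eq_mul, op_smul_eq_mul]
    exact (map_mul (DoubleCentralizer.coeHom (𝕜 := ℂ) (A := A)) _ _).symm⟩

theorem Dual.restrict_comp (α : Dual 𝓜(ℂ, A) (MultiplierModule A N)) (β : MultiplierModule A N) :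
    (Dual.restrict α).1 ∘L β.1 = (α.1 β).fst :=
  ContinuousLinearMap.ext fun a => (coeMultiplier A).injective <|
    (Dual.coeMultiplier_restrictCLM α (β.1 a)).trans (Dual.apply_toMultiplierModule_apply α β a)

theorem Dual.isLocallyAdjointable_restrict (α : Dual 𝓜(ℂ, A) (MultiplierModule A N)) :
    IsLocallyAdjointable A (Dual.restrict α).1 :=
  (isLocallyAdjointable_iff_exists_fst_eq_comp _).2 ⟨α, fun β => (Dual.restrict_comp α β).symm⟩

variable (A N) in
/-- The isometric isomorphism `N'_{LA} ≅ M(N)'`, given by `Γ ↦ (β ↦ Γ ∘ β)`. -/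
noncomputable def dualLAEquiv : DualLA A N ≃ₗᵢ[ℂ] Dual 𝓜(ℂ, A) (MultiplierModule A N) where
  toFun := DualLA.extend
  invFun α := ⟨(Dual.restrict α).1, Dual.isLocallyAdjointable_restrict α⟩
  map_add' _ _ := Subtype.ext (ContinuousLinearMap.ext fun _ => multiplier_ext fun _ => rfl)
  map_smul' _ _ := Subtype.ext (ContinuousLinearMap.ext fun _ => multiplier_ext fun _ => rfl)
  left_inv Γ := Subtype.ext <| ContinuousLinearMap.ext fun x => (coeMultiplier A).injective <|
    (Dual.coeMultiplier_restrictCLM _ x).trans (DualLA.extend_toMultiplierModule Γ x)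
  right_inv α := Subtype.ext <| ContinuousLinearMap.ext fun β => multiplier_ext fun a =>
    congrArg (· a) (Dual.restrict_comp α β)
  norm_map' := DualLA.norm_extend

theorem dualLAEquiv_apply_fst (Γ : DualLA A N) (β : MultiplierModule A N) :
    ((dualLAEquiv A N Γ).1 β).fst = Γ.1 ∘L β.1 := rfl

theorem dualLAEquiv_act (Γ : DualLA A N) (m : 𝓜(ℂ, A)) :
    dualLAEquiv A N (DualLA.act Γ m) = Dual.act (dualLAEquiv A N Γ) m :=
  Subtype.ext (ContinuousLinearMap.ext fun _ => multiplier_ext fun _ => rfl)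

end Duality

namespace L2

variable {A : Type*} [NonUnitalCStarAlgebra A]

/-- The inclusion of `A` in `ℓ²(A)` as the `i`-th summand. -/
noncomputable def single (i : ℕ) : A →ₗ[ℂ] L2 A where
  toFun a := ⟨Pi.single i a, summable_of_ne_finset_zero (s := {i}) fun j hj => by
    rw [Pi.single_eq_of_ne (by simpa using hj), mul_zero]⟩
  map_add' a b := Subtype.ext (Pi.single_add (f := fun _ => A) i a b)
  map_smul' c a := Subtype.ext (Pi.single_smul (f := fun _ => A) i c a)

@[simp] theorem coord_single_self (i : ℕ) (a : A) : (single i a).coord i = a :=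
  Pi.single_eq_same (M := fun _ => A) i a

theorem coord_single_of_ne {i j : ℕ} (a : A) (h : j ≠ i) : (single i a).coord j = 0 :=
  Pi.single_eq_of_ne (M := fun _ => A) h a

theorem ip_single_left (i : ℕ) (a : A) (x : L2 A) : ip A (single i a) x = star a * x.coord i := by
  change ∑' j, star ((single i a).coord j) * x.coord j = _
  rw [tsum_eq_single i fun j hj => by rw [coord_single_of_ne a hj, star_zero, zero_mul],
    coord_single_self]

theorem ip_single_right (i : ℕ) (a : A) (x : L2 A) :
    ip A x (single i a) = star (x.coord i) * a := by
  rw [← star_ip, ip_single_left, star_mul, star_star]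

theorem norm_single (i : ℕ) (a : A) : ‖single i a‖ = ‖a‖ := by
  rw [← sq_eq_sq₀ (norm_nonneg _) (norm_nonneg _), norm_sq_eq A, ip_single_left,
    coord_single_self, CStarRing.norm_star_mul_self, sq]

theorem norm_coord_le (x : L2 A) (i : ℕ) : ‖x.coord i‖ ≤ ‖x‖ := by
  have h : ‖x.coord i‖ * ‖x.coord i‖ ≤ ‖x.coord i‖ * ‖x‖ := by
    simpa only [ip_single_left, norm_single, CStarRing.norm_star_mul_self] using
      norm_ip_le A (single i (x.coord i)) x
  rcases (norm_nonneg (x.coord i)).eq_or_lt with h0 | hpos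
  · exact h0 ▸ norm_nonneg x
  · exact le_of_mul_le_mul_left h hpos

/-- The inclusion of `A` in `ℓ²(A)` as the `i`-th summand, as a bounded operator. -/
noncomputable def singleCLM (i : ℕ) : A →L[ℂ] L2 A :=
  LinearIsometry.toContinuousLinearMap ⟨single i, norm_single i⟩

@[simp] theorem singleCLM_apply (i : ℕ) (a : A) : singleCLM i a = single i a := rfl

/-- The `i`-th coordinate as a bounded operator, the adjoint of `singleCLM i`. -/
noncomputable def coordCLM (i : ℕ) : L2 A →L[ℂ] A :=
  LinearMap.mkContinuous
    { toFun := fun x => x.coord i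
      map_add' := fun _ _ => rfl
      map_smul' := fun _ _ => rfl } 1 fun x => by
    rw [one_mul]; exact norm_coord_le x i

theorem single_mul (i : ℕ) (a b : A) : single i (a * b) = op b • single i a :=
  ext_ip A fun x => by rw [ip_act_right, ip_single_right, ip_single_right, mul_assoc]

theorem isAdjointable_singleCLM (i : ℕ) : IsAdjointable A (singleCLM (A := A) i) :=
  ⟨fun b a => single_mul i a b, coordCLM i, fun _ _ => rfl, ip_single_left i⟩

theorem coord_sum_single_of_mem (x : L2 A) {s : Finset ℕ} {j : ℕ} (hj : j ∈ s) :
    (∑ i ∈ s, single i (x.coord i)).coord j = x.coord j :=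
  calc (∑ i ∈ s, single i (x.coord i)).coord j
      = ∑ i ∈ s, (single i (x.coord i)).coord j := map_sum (coordCLM j) _ s
    _ = (single j (x.coord j)).coord j :=
        Finset.sum_eq_single_of_mem j hj fun _ _ hij => coord_single_of_ne _ hij.symm
    _ = x.coord j := coord_single_self j _

/-- The difference is orthogonal to the partial sum, whose coordinates in `s` are those of `x`. -/
theorem norm_sub_sum_single_sq (x : L2 A) (s : Finset ℕ) :
    ‖x - ∑ i ∈ s, single i (x.coord i)‖ ^ 2 =
      ‖ip A x x - ∑ i ∈ s, star (x.coord i) * x.coord i‖ := by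
  set p := ∑ i ∈ s, single i (x.coord i) with hp
  have ip_p : ∀ y, ip A y p = ∑ i ∈ s, star (y.coord i) * x.coord i := fun y => by
    simp only [hp, ip_sum_right, ip_single_right]
  have orthogonal : ip A (x - p) p = 0 := by
    rw [ip_sub_left, ip_p, ip_p, sub_eq_zero]
    exact Finset.sum_congr rfl fun i hi => by rw [coord_sum_single_of_mem x hi]
  calc ‖x - p‖ ^ 2 = ‖ip A (x - p) x‖ := by
        rw [norm_sq_eq A, ip_sub_right, orthogonal, sub_zero]
    _ = ‖ip A x (x - p)‖ := by rw [← star_ip, norm_star]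
    _ = _ := by rw [ip_sub_right, ip_p]

theorem hasSum_single (x : L2 A) : HasSum (fun i => single i (x.coord i)) x := by
  have hself : Tendsto (fun s : Finset ℕ => ∑ i ∈ s, star (x.coord i) * x.coord i) atTop
      (𝓝 (ip A x x)) := x.summable_self.hasSum
  have hsq : Tendsto (fun s : Finset ℕ => ‖∑ i ∈ s, single i (x.coord i) - x‖ ^ 2) atTop (𝓝 0) := by
    simpa only [norm_sub_rev, norm_sub_sum_single_sq] using
      tendsto_iff_norm_sub_tendsto_zero.1 hself
  refine tendsto_iff_norm_sub_tendsto_zero.2 ?_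
  simpa using hsq.sqrt

end L2

section Coefficients

variable {A : Type*} [NonUnitalCStarAlgebra A]

theorem RM.ext_starMul {g h : RM A} (H : ∀ a, RM.starMul g a = RM.starMul h a) : g = h :=
  Subtype.ext (ContinuousLinearMap.ext fun a => by simpa [RM.starMul] using H (star a))

theorem RM.starMul_zero (g : RM A) : RM.starMul g 0 = 0 := by simp [RM.starMul]

theorem RM.starMul_ofMultiplier (m : 𝓜(ℂ, A)) (a : A) :
    RM.starMul (RM.ofMultiplier m) a = (star m).fst a :=
  (DoubleCentralizer.star_fst m a).symm

/-- The coefficient `Γ_i ∈ RM(A)` of a functional on `ℓ²(A)`: the right multiplier for which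
`Γ_i^*` is the restriction of `Γ` to the `i`-th summand. -/
noncomputable def Dual.coeff (Γ : Dual A (L2 A)) (i : ℕ) : RM A :=
  ⟨starConj (Γ.1 ∘L L2.singleCLM i), fun b a => by
    simp only [starConj_apply, ContinuousLinearMap.comp_apply, L2.singleCLM_apply, star_mul,
      L2.single_mul, Γ.2 (star b), op_smul_eq_mul, star_star]⟩

theorem Dual.starMul_coeff (Γ : Dual A (L2 A)) (i : ℕ) (a : A) :
    RM.starMul (Dual.coeff Γ i) a = Γ.1 (L2.single i a) := by
  simp only [RM.starMul, Dual.coeff, starConj_apply, ContinuousLinearMap.comp_apply,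
    L2.singleCLM_apply, star_star]

theorem isCoeff_iff {Γ : Dual A (L2 A)} {g : ℕ → RM A} :
    IsCoeff Γ g ↔ ∀ i a, RM.starMul (g i) a = Γ.1 (L2.single i a) := by
  refine ⟨fun hg i a => ?_, fun hg x => ?_⟩
  · refine tendsto_nhds_unique (tendsto_const_nhds.congr' ?_) (hg (L2.single i a))
    filter_upwards [eventually_gt_atTop i] with n hn
    rw [Finset.sum_eq_single_of_mem i (Finset.mem_range.2 hn) fun j _ hj => by
      rw [L2.coord_single_of_ne a hj, RM.starMul_zero], L2.coord_single_self]
  · simpa only [hg] using ((L2.hasSum_single x).mapL Γ.1).tendsto_sum_nat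

theorem existsUnique_isCoeff (Γ : Dual A (L2 A)) : ∃! g : ℕ → RM A, IsCoeff Γ g :=
  ⟨Dual.coeff Γ, isCoeff_iff.2 (Dual.starMul_coeff Γ), fun _ hg => funext fun i =>
    RM.ext_starMul fun a => (isCoeff_iff.1 hg i a).trans (Dual.starMul_coeff Γ i a).symm⟩

theorem IsCoeff.tendsto_sum_star_fst {Γ : Dual A (L2 A)} {m : ℕ → 𝓜(ℂ, A)}
    (h : IsCoeff Γ fun i => RM.ofMultiplier (m i)) (x : L2 A) :
    Tendsto (fun n => ∑ i ∈ Finset.range n, (star (m i)).fst (x.coord i)) atTop (𝓝 (Γ.1 x)) := by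
  simpa only [RM.starMul_ofMultiplier] using h x

theorem IsCoeff.defines_iff {Γ : Dual A (L2 A)} {g : ℕ → RM A} (h : IsCoeff Γ g)
    {α : Dual 𝓜(ℂ, A) (MultiplierModule A (L2 A))} :
    Defines g α ↔ ∀ β, (α.1 β).fst = Γ.1 ∘L β.1 := by
  constructor
  · rintro ⟨m, hm, hα⟩ β
    obtain rfl : (fun i => RM.ofMultiplier (m i)) = g := funext hm
    exact ContinuousLinearMap.ext fun a =>
      tendsto_nhds_unique (hα β a) (h.tendsto_sum_star_fst (β.1 a))
  · intro hα
    let m (i : ℕ) : 𝓜(ℂ, A) := star (α.1 ⟨L2.singleCLM i, L2.isAdjointable_singleCLM i⟩)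
    have hm (i : ℕ) : RM.ofMultiplier (m i) = g i := RM.ext_starMul fun a => by
      rw [RM.starMul_ofMultiplier, star_star, hα, isCoeff_iff.1 h]
      rfl
    obtain rfl : (fun i => RM.ofMultiplier (m i)) = g := funext hm
    exact ⟨m, fun _ => rfl, fun β a => by rw [hα]; exact h.tendsto_sum_star_fst (β.1 a)⟩

end Coefficients

end HilbertCStar

open HilbertCStar in
theorem mainTheorem1 (A : Type*) [NonUnitalCStarAlgebra A] :
    (∀ Γ : Dual A (L2 A), ∃! g : ℕ → RM A, IsCoeff Γ g) ∧
    (∀ (Γ : Dual A (L2 A)) (g : ℕ → RM A), IsCoeff Γ g →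
      (IsLocallyAdjointable A Γ.1 ↔
        ∃ α : Dual 𝓜(ℂ, A) (MultiplierModule A (L2 A)), Defines g α)) ∧
    ∃ Φ : DualLA A (L2 A) ≃ₗᵢ[ℂ] Dual 𝓜(ℂ, A) (MultiplierModule A (L2 A)),
      (∀ (Γ : DualLA A (L2 A)) (m : 𝓜(ℂ, A)), Φ (DualLA.act Γ m) = Dual.act (Φ Γ) m) ∧
      (∀ (Γ : DualLA A (L2 A)) (g : ℕ → RM A), IsCoeff ⟨Γ.1, Γ.2.1⟩ g → Defines g (Φ Γ)) := by
  refine ⟨existsUnique_isCoeff, fun Γ g hg => ?_, dualLAEquiv A (L2 A), dualLAEquiv_act,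
    fun Γ g hg => hg.defines_iff.2 (dualLAEquiv_apply_fst Γ)⟩
  simp only [isLocallyAdjointable_iff_exists_fst_eq_comp, hg.defines_iff]
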